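/- Let $(M,g)$ be a smooth $n$-dimensional manifold with a smooth pseudo-Riemannian metric of arbitrary signature and Levi-Civita connection $\nabla$. Round brackets $(\cdot)$ and square brackets $[\cdot]$ around indices denote symmetrization and antisymmetrization with weight $1/m!$ ($m$ the number of indices involved). The Riemann tensor is fixed by $(\nabla_a\nabla_b-\nabla_b\nabla_a)Y_c=R_{abc}{}^{f}Y_f$, the Ricci tensor is $R_{ab}=R^{c}{}_{acb}$, and $C_{abcd}$ is the Weyl tensor (for $n\le 2$, where the Weyl tensor is not defined, the term containing it below is understood to be zero). Let $A$ be a Killing–Yano tensor of order $p\ge 2$ on $M$, i.e. a smooth totally skew-symmetric covariant tensor field of rank $p$ with $$\nabla_a A_{b_1\cdots b_p}=\nabla_{[a}A_{b_1\cdots b_p]} .$$ Write $E=e_3\cdots e_p$ for a string of $p-2$ indices and set $$R^{\hat f}{}_{\hat e\,uv}A_{wx\hat F}=\sum_{i=3}^{p}R^{f}{}_{e_i uv}\,A_{wx\,e_3\cdots e_{i-1}\,f\,e_{i+1}\cdots e_p},\qquad C^{a\hat f}{}_{\hat e\,c}A_{da\hat F}=\sum_{i=3}^{p}C^{af}{}_{e_i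 c}\,A_{da\,e_3\cdots e_{i-1}\,f\,e_{i+1}\cdots e_p}$$ (both zero if $p=2$). Then, at every point and in all components, $$0=R^f{}_{acb}A_{dfE}+R^f{}_{bda}A_{cfE}+R^f{}_{cad}A_{bfE}+R^f{}_{dbc}A_{afE}+R^{\hat f}{}_{\hat e[bc}A_{d]a\hat F}+2R^{\hat f}{}_{\hat e a[b}A_{cd]\hat F}+2R^{\hat f}{}_{\hat e bc}A_{ad\hat F}-3R^{\hat f}{}_{\hat e[ab}A_{c]d\hat F}$$ and $$2(n-p)\,R^f{}_{(c}A_{d)fE}+(n-2)\,C^{a\hat f}{}_{\hat e(c}A_{d)a\hat F}=0 .$$ -/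

import Mathlib

open scoped Manifold ContDiff

namespace KillingYano

noncomputable section

/-- The coordinate space `ℝⁿ`. -/
abbrev Coord (n : ℕ) : Type := EuclideanSpace ℝ (Fin n)

/-! ### Index calculus in one coordinate system

Fields are functions of the coordinates `y`; `G y` is the matrix of components `g_{ab}` at `y`. -/

/-- The partial derivative `∂_a u` at `y`. -/
def partialDeriv {n : ℕ} (a : Fin n) (u : Coord n → ℝ) (y : Coord n) : ℝ :=
  fderiv ℝ u y (EuclideanSpace.single a 1)

/-- The Christoffel symbol `Γ^f_{ab}` of the Levi-Civita connection. -/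
def christoffel {n : ℕ} (G : Coord n → Matrix (Fin n) (Fin n) ℝ) (y : Coord n)
    (f a b : Fin n) : ℝ :=
  (1 / 2) * ∑ e, (G y)⁻¹ f e *
    (partialDeriv a (fun z => G z e b) y + partialDeriv b (fun z => G z e a) y
      - partialDeriv e (fun z => G z a b) y)

/-- The covariant derivative `∇_a T_{b_1 ⋯ b_p}` of a covariant tensor field of rank `p`. -/
def covDeriv {n p : ℕ} (G : Coord n → Matrix (Fin n) (Fin n) ℝ)
    (T : Coord n → (Fin p → Fin n) → ℝ) (y : Coord n) (a : Fin n) (b : Fin p → Fin n) : ℝ :=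
  partialDeriv a (fun z => T z b) y
    - ∑ i, ∑ f, christoffel G y f a (b i) * T y (Function.update b i f)

/-- The Riemann tensor `R_{abc}{}^f`, with the convention
`(∇_a ∇_b - ∇_b ∇_a) Y_c = R_{abc}{}^f Y_f`. -/
def riemann {n : ℕ} (G : Coord n → Matrix (Fin n) (Fin n) ℝ) (y : Coord n)
    (a b c f : Fin n) : ℝ :=
  partialDeriv b (fun z => christoffel G z f a c) y
    - partialDeriv a (fun z => christoffel G z f b c) y
    + ∑ e, (christoffel G y f b e * christoffel G y e a c
      - christoffel G y f a e * christoffel G y e b c)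

/-- The totally covariant Riemann tensor `R_{abcd} = R_{abc}{}^f g_{fd}`. -/
def riemannLow {n : ℕ} (G : Coord n → Matrix (Fin n) (Fin n) ℝ) (y : Coord n)
    (a b c d : Fin n) : ℝ :=
  ∑ f, riemann G y a b c f * G y f d

/-- The Riemann tensor with its first index raised, `R^f{}_{abc} = g^{fe} R_{eabc}`. -/
def riemannUp {n : ℕ} (G : Coord n → Matrix (Fin n) (Fin n) ℝ) (y : Coord n)
    (f a b c : Fin n) : ℝ :=
  ∑ e, (G y)⁻¹ f e * riemannLow G y e a b c

/-- The Ricci tensor `R_{ab} = R^c{}_{acb}`. -/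
def ricci {n : ℕ} (G : Coord n → Matrix (Fin n) (Fin n) ℝ) (y : Coord n)
    (a b : Fin n) : ℝ :=
  ∑ c, riemannUp G y c a c b

/-- The Ricci tensor with one index raised, `R^a{}_b = g^{ae} R_{eb}`. -/
def ricciUp {n : ℕ} (G : Coord n → Matrix (Fin n) (Fin n) ℝ) (y : Coord n)
    (a b : Fin n) : ℝ :=
  ∑ e, (G y)⁻¹ a e * ricci G y e b

/-- The Ricci scalar `R^a{}_a`. -/
def scalarCurv {n : ℕ} (G : Coord n → Matrix (Fin n) (Fin n) ℝ) (y : Coord n) : ℝ :=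
  ∑ a, ricciUp G y a a

/-- The Weyl tensor `C_{abcd}` (meaningful for `n ≥ 3`). -/
def weyl {n : ℕ} (G : Coord n → Matrix (Fin n) (Fin n) ℝ) (y : Coord n)
    (a b c d : Fin n) : ℝ :=
  riemannLow G y a b c d
    - (1 / ((n : ℝ) - 2)) * (G y a c * ricci G y b d - G y a d * ricci G y b c
        - G y b c * ricci G y a d + G y b d * ricci G y a c)
    + (scalarCurv G y / (((n : ℝ) - 1) * ((n : ℝ) - 2)))
        * (G y a c * G y b d - G y a d * G y b c)

/-- The Weyl tensor with its first two indices raised, `C^{ab}{}_{cd}`. -/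
def weylUp {n : ℕ} (G : Coord n → Matrix (Fin n) (Fin n) ℝ) (y : Coord n)
    (a b c d : Fin n) : ℝ :=
  ∑ e, ∑ f, (G y)⁻¹ a e * (G y)⁻¹ b f * weyl G y e f c d

/-- Antisymmetrization `T_{[s_1 ⋯ s_m]}`, with the weight `1 / m!`. -/
def antisymm {n m : ℕ} (T : (Fin m → Fin n) → ℝ) (s : Fin m → Fin n) : ℝ :=
  (1 / (m.factorial : ℝ)) *
    ∑ σ : Equiv.Perm (Fin m), ((Equiv.Perm.sign σ : ℤ) : ℝ) * T (fun i => s (σ i))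

/-- Symmetrization `T_{(cd)}`, with the weight `1 / 2`. -/
def symm2 {n : ℕ} (T : Fin n → Fin n → ℝ) (c d : Fin n) : ℝ :=
  (1 / 2) * (T c d + T d c)

/-- The multi-index `c d e_1 ⋯ e_k`. -/
def idx {n k : ℕ} (c d : Fin n) (E : Fin k → Fin n) : Fin (k + 2) → Fin n :=
  Fin.cons c (Fin.cons d E)

/-! ### Metrics and forms on a manifold -/

/-- The coordinate vector `∂_i` of the chart `φ`, at the point of `M` with coordinates `y`. -/
def coordVec {n : ℕ} {M : Type*} [TopologicalSpace M] [ChartedSpace (Coord n) M]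
    (φ : OpenPartialHomeomorph M (Coord n)) (y : Coord n) (i : Fin n) :
    TangentSpace (𝓡 n) (φ.symm y) :=
  mfderiv (𝓡 n) (𝓡 n) φ.symm y (EuclideanSpace.single i (1 : ℝ) : Coord n)

/-- A smooth pseudo-Riemannian metric of arbitrary signature: a nondegenerate symmetric bilinear
form on every tangent space, with smooth components in every chart of the smooth structure. -/
structure PseudoMetric (n : ℕ) (M : Type*) [TopologicalSpace M] [ChartedSpace (Coord n) M] where
  val : ∀ x : M, TangentSpace (𝓡 n) x →L[ℝ] TangentSpace (𝓡 n) x →L[ℝ] ℝ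
  symm : ∀ x v w, val x v w = val x w v
  nondegenerate : ∀ x v, (∀ w, val x v w = 0) → v = 0
  smooth : ∀ φ ∈ IsManifold.maximalAtlas (𝓡 n) ∞ M, ∀ i j : Fin n,
    ContDiffOn ℝ ∞ (fun y => val (φ.symm y) (coordVec φ y i) (coordVec φ y j)) φ.target

/-- A smooth totally skew-symmetric covariant tensor field of rank `p`. -/
structure SkewTensor (n p : ℕ) (M : Type*) [TopologicalSpace M] [ChartedSpace (Coord n) M] where
  val : ∀ x : M, TangentSpace (𝓡 n) x [⋀^Fin p]→L[ℝ] ℝ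
  smooth : ∀ φ ∈ IsManifold.maximalAtlas (𝓡 n) ∞ M, ∀ b : Fin p → Fin n,
    ContDiffOn ℝ ∞ (fun y => val (φ.symm y) (fun i => coordVec φ y (b i))) φ.target

/-- The components `g_{ij}` of the metric in the chart `φ`. -/
def PseudoMetric.coord {n : ℕ} {M : Type*} [TopologicalSpace M] [ChartedSpace (Coord n) M]
    (g : PseudoMetric n M) (φ : OpenPartialHomeomorph M (Coord n)) (y : Coord n) :
    Matrix (Fin n) (Fin n) ℝ :=
  Matrix.of fun i j => g.val (φ.symm y) (coordVec φ y i) (coordVec φ y j)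

/-- The components `A_{b_1 ⋯ b_p}` of a skew-symmetric tensor field in the chart `φ`. -/
def SkewTensor.coord {n p : ℕ} {M : Type*} [TopologicalSpace M] [ChartedSpace (Coord n) M]
    (A : SkewTensor n p M) (φ : OpenPartialHomeomorph M (Coord n)) (y : Coord n)
    (b : Fin p → Fin n) : ℝ :=
  A.val (φ.symm y) (fun i => coordVec φ y (b i))

/-- The components `R^f{}_{abc}` of the Riemann tensor of `g` in the chart `φ`. -/
def PseudoMetric.riem {n : ℕ} {M : Type*} [TopologicalSpace M] [ChartedSpace (Coord n) M]
    (g : PseudoMetric n M) (φ : OpenPartialHomeomorph M (Coord n)) (y : Coord n) :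
    Fin n → Fin n → Fin n → Fin n → ℝ :=
  riemannUp (g.coord φ) y

/-- The components `R^a{}_b` of the Ricci tensor of `g` in the chart `φ`. -/
def PseudoMetric.ric {n : ℕ} {M : Type*} [TopologicalSpace M] [ChartedSpace (Coord n) M]
    (g : PseudoMetric n M) (φ : OpenPartialHomeomorph M (Coord n)) (y : Coord n) :
    Fin n → Fin n → ℝ :=
  ricciUp (g.coord φ) y

/-- The components `C^{ab}{}_{cd}` of the Weyl tensor of `g` in the chart `φ`. -/
def PseudoMetric.wey {n : ℕ} {M : Type*} [TopologicalSpace M] [ChartedSpace (Coord n) M]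
    (g : PseudoMetric n M) (φ : OpenPartialHomeomorph M (Coord n)) (y : Coord n) :
    Fin n → Fin n → Fin n → Fin n → ℝ :=
  weylUp (g.coord φ) y

/-- `A` is a Killing-Yano tensor of order `p`: `∇_a A_{b_1 ⋯ b_p} = ∇_{[a} A_{b_1 ⋯ b_p]}` in
every chart of the smooth structure; below, `s` is the multi-index `a b_1 ⋯ b_p`. -/
def IsKillingYano {n p : ℕ} {M : Type*} [TopologicalSpace M] [ChartedSpace (Coord n) M]
    (g : PseudoMetric n M) (A : SkewTensor n p M) : Prop :=
  ∀ φ ∈ IsManifold.maximalAtlas (𝓡 n) ∞ M, ∀ y ∈ φ.target, ∀ s : Fin (p + 1) → Fin n,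
    covDeriv (g.coord φ) (A.coord φ) y (s 0) (Fin.tail s) =
      antisymm (fun t => covDeriv (g.coord φ) (A.coord φ) y (t 0) (Fin.tail t)) s

/-- The hatted contraction `R^{f̂}{}_{ê u v} A_{w x F̂}`, that is the sum over the positions `i` of
`R^f{}_{e_i u v} A_{w x e_1 ⋯ f ⋯ e_k}`, the summed index `f` standing in the place of `e_i`. -/
def hatRiemann {n k : ℕ} (R : Fin n → Fin n → Fin n → Fin n → ℝ)
    (A : (Fin (k + 2) → Fin n) → ℝ) (E : Fin k → Fin n) (u v w x : Fin n) : ℝ :=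
  ∑ i, ∑ f, R f (E i) u v * A (idx w x (Function.update E i f))

/-- The hatted contraction `C^{a f̂}{}_{ê c} A_{d a F̂}`, that is the sum over the positions `i` of
`C^{af}{}_{e_i c} A_{d a e_1 ⋯ f ⋯ e_k}`, the summed index `f` standing in the place of `e_i`. -/
def hatWeyl {n k : ℕ} (C : Fin n → Fin n → Fin n → Fin n → ℝ)
    (A : (Fin (k + 2) → Fin n) → ℝ) (E : Fin k → Fin n) (c d : Fin n) : ℝ :=
  ∑ i, ∑ a, ∑ f, C a f (E i) c * A (idx d a (Function.update E i f))

end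

end KillingYano

/-! The Killing–Yano equation says that `B = ∇A` is totally skew. Hence `∇_a B_{bcdE}` is skew in
all indices after `a`, and the Ricci identity turns its antisymmetrization in `a, b` into the purely
algebraic `K_{ab|cd} = (R_{ab} · A)_{cdE}`, where `R_{ab}` acts as a derivation. By skewness of `B`,
the sum `K_{ab|cd} + K_{cd|ab}` is the alternating sum of `∇_a B_{bcdE}` over the choice of the
differentiating index among `a, b, c, d`. It is therefore the same for the three ways `P₁ =
(ab|cd)`, `P₂ = (ac|db)`, `P₃ = (ad|bc)` of splitting these indices into pairs
(`IsKillingYanoOn.integrability`).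

The first identity is `0 = (P₁ + P₂ - 2 P₃) / 3` with the derivations written out. The hatted terms
collect the action on `E`; the first Bianchi identity merges the terms in which `c` or `d` is hit.

For the second identity, `P₁ = P₃` is traced with `g^{ab}`. The left side vanishes by skewness, so
the trace `T_{cd} = g^{ab} K_{ca|bd}` has no symmetric part (`commTrace_symm`). Expanding `T` gives
a Ricci term, a term skew in `c, d`, and a Riemann contraction over the slots of `E`
(`commTrace_eq`). The last is half of the hatted Weyl term, up to Ricci terms and a multiple of
`A_{cdE}` (`hatWeyl_eq`); its Ricci part changes the coefficient from `n - 2` to `n - p`. -/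

namespace KillingYano

/-! ### Partial derivatives of smooth functions on an open set of `ℝⁿ`. -/

section Calculus

variable {n : ℕ}

theorem partialDeriv_sub {a : Fin n} {u v : Coord n → ℝ} {y : Coord n}
    (hu : DifferentiableAt ℝ u y) (hv : DifferentiableAt ℝ v y) :
    partialDeriv a (fun z => u z - v z) y = partialDeriv a u y - partialDeriv a v y := by
  simp [partialDeriv, fderiv_fun_sub hu hv]

theorem partialDeriv_mul {a : Fin n} {u v : Coord n → ℝ} {y : Coord n}
    (hu : DifferentiableAt ℝ u y) (hv : DifferentiableAt ℝ v y) :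
    partialDeriv a (fun z => u z * v z) y = partialDeriv a u y * v y + u y * partialDeriv a v y := by
  simp [partialDeriv, fderiv_fun_mul hu hv]; ring

theorem partialDeriv_const_mul {a : Fin n} {u : Coord n → ℝ} {y : Coord n} (r : ℝ)
    (hu : DifferentiableAt ℝ u y) :
    partialDeriv a (fun z => r * u z) y = r * partialDeriv a u y := by
  simp [partialDeriv, fderiv_const_mul hu r]

theorem partialDeriv_sum {ι : Type*} [Fintype ι] {a : Fin n} {u : ι → Coord n → ℝ} {y : Coord n}
    (hu : ∀ i, DifferentiableAt ℝ (u i) y) :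
    partialDeriv a (fun z => ∑ i, u i z) y = ∑ i, partialDeriv a (u i) y := by
  simp [partialDeriv, fderiv_fun_sum (fun i _ => hu i)]

theorem partialDeriv_congr {a : Fin n} {u v : Coord n → ℝ} {U : Set (Coord n)} (hU : IsOpen U)
    (h : Set.EqOn u v U) {y : Coord n} (hy : y ∈ U) : partialDeriv a u y = partialDeriv a v y := by
  rw [partialDeriv, partialDeriv, (h.eventuallyEq_of_mem (hU.mem_nhds hy)).fderiv_eq]

theorem contDiffOn_partialDeriv {u : Coord n → ℝ} {U : Set (Coord n)} (hU : IsOpen U)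
    (hu : ContDiffOn ℝ ∞ u U) (a : Fin n) : ContDiffOn ℝ ∞ (partialDeriv a u) U :=
  (hu.fderiv_of_isOpen hU (by simp)).clm_apply contDiffOn_const

theorem differentiableAt_of_contDiffOn {u : Coord n → ℝ} {U : Set (Coord n)} (hU : IsOpen U)
    (hu : ContDiffOn ℝ ∞ u U) {y : Coord n} (hy : y ∈ U) : DifferentiableAt ℝ u y :=
  (hu.contDiffAt (hU.mem_nhds hy)).differentiableAt (by simp)

theorem partialDeriv_comm {u : Coord n → ℝ} {U : Set (Coord n)} (hU : IsOpen U)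
    (hu : ContDiffOn ℝ ∞ u U) {y : Coord n} (hy : y ∈ U) (a b : Fin n) :
    partialDeriv a (partialDeriv b u) y = partialDeriv b (partialDeriv a u) y := by
  have h1 : DifferentiableAt ℝ (fderiv ℝ u) y :=
    ((hu.fderiv_of_isOpen hU (m := ∞) (by simp)).contDiffAt (hU.mem_nhds hy)).differentiableAt
      (by simp)
  have key : ∀ a b : Fin n, partialDeriv a (partialDeriv b u) y =
      fderiv ℝ (fderiv ℝ u) y (EuclideanSpace.single a 1) (EuclideanSpace.single b 1) := by
    intro a b
    change fderiv ℝ (fun z => fderiv ℝ u z (EuclideanSpace.single b 1)) y _ = _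
    rw [fderiv_clm_apply h1 (differentiableAt_const _)]
    simp
  rw [key, key]
  -- Schwarz's theorem; the side goal is that smoothness `∞` is at least `2`.
  exact ((hu.contDiffAt (hU.mem_nhds hy)).isSymmSndFDerivAt (by
    simpa using WithTop.coe_le_coe.2 (le_top (a := (2 : ℕ∞))))) _ _

end Calculus

/-! ### Endomorphisms acting on covariant tensors as derivations. -/

section Derivation

variable {n p : ℕ}

/-- The action of an endomorphism with components `X^f_c` as a derivation on covariant tensors. -/
def derivAct (X : Fin n → Fin n → ℝ) (T : (Fin p → Fin n) → ℝ) (b : Fin p → Fin n) : ℝ :=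
  ∑ i, ∑ f, X f (b i) * T (Function.update b i f)

/-- Actions on two different slots commute and cancel; only the terms hitting the same slot twice
survive, and they assemble into a matrix commutator. This produces the `ΓΓ` part of the curvature in
the Ricci identity. -/
theorem derivAct_comm_sub (X Y : Fin n → Fin n → ℝ) (T : (Fin p → Fin n) → ℝ)
    (b : Fin p → Fin n) :
    derivAct X (derivAct Y T) b - derivAct Y (derivAct X T) b =
      derivAct (fun f c => ∑ e, (Y f e * X e c - X f e * Y e c)) T b := by
  classical
  have key : ∀ X Y : Fin n → Fin n → ℝ, derivAct X (derivAct Y T) b =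
      derivAct (fun f c => ∑ e, Y f e * X e c) T b +
      ∑ i, ∑ j ∈ Finset.univ.erase i, ∑ f, ∑ h, X f (b i) * Y h (b j) *
        T (Function.update (Function.update b i f) j h) := by
    intro X Y
    simp only [derivAct, ← Finset.sum_add_distrib]
    refine Finset.sum_congr rfl fun i _ => ?_
    simp only [Finset.mul_sum, Finset.sum_mul]
    -- Separate the diagonal `j = i`, where the second update overwrites the first.
    rw [Finset.sum_comm, ← Finset.add_sum_erase _ _ (Finset.mem_univ i)]
    congr 1
    · rw [Finset.sum_comm]
      refine Finset.sum_congr rfl fun f _ => Finset.sum_congr rfl fun h _ => ?_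
      simp only [Function.update_self, Function.update_idem]
      ring
    · refine Finset.sum_congr rfl fun j hj => Finset.sum_congr rfl fun f _ =>
        Finset.sum_congr rfl fun h _ => ?_
      rw [Function.update_of_ne (Finset.ne_of_mem_erase hj)]
      ring
  have cross : ∑ i, ∑ j ∈ Finset.univ.erase i, ∑ f, ∑ h, X f (b i) * Y h (b j) *
        T (Function.update (Function.update b i f) j h) =
      ∑ i, ∑ j ∈ Finset.univ.erase i, ∑ f, ∑ h, Y f (b i) * X h (b j) *
        T (Function.update (Function.update b i f) j h) := by
    rw [Finset.sum_comm' (t' := Finset.univ) (s' := fun j => Finset.univ.erase j)]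
    · refine Finset.sum_congr rfl fun j _ => Finset.sum_congr rfl fun i hi => ?_
      rw [Finset.sum_comm]
      refine Finset.sum_congr rfl fun f _ => Finset.sum_congr rfl fun h _ => ?_
      rw [Function.update_comm (Finset.ne_of_mem_erase hi)]
      ring
    · intro i j
      simp [eq_comm]
  rw [key X Y, key Y X, cross]
  simp only [derivAct, Finset.sum_sub_distrib, sub_mul]
  ring

/-- Permuting the arguments only reindexes the sum over slots. With `r` the sign of `σ`, skewness
passes to the derived tensor. -/
theorem derivAct_comp_perm (X : Fin n → Fin n → ℝ) (T T' : (Fin p → Fin n) → ℝ) (r : ℝ)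
    (σ : Equiv.Perm (Fin p)) (hT : ∀ s, T (s ∘ σ) = r * T' s) (b : Fin p → Fin n) :
    derivAct X T (b ∘ σ) = r * derivAct X T' b := by
  simp only [derivAct, Finset.mul_sum]
  refine Fintype.sum_equiv σ _ _ fun i => Finset.sum_congr rfl fun f _ => ?_
  have : Function.update (b ∘ σ) i f = Function.update b (σ i) f ∘ σ := by
    have := Function.update_comp_equiv b σ (σ i) f
    simpa using this.symm
  rw [this, hT]
  simp only [Function.comp_apply]
  ring

end Derivation

/-! ### The Levi-Civita connection in coordinates and the Ricci identity. -/

section Connection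

variable {n p : ℕ}

/-- `G` is the component matrix of a smooth pseudo-Riemannian metric on the open set `U`. -/
structure IsMetricOn (G : Coord n → Matrix (Fin n) (Fin n) ℝ) (U : Set (Coord n)) : Prop where
  isOpen : IsOpen U
  smooth : ∀ i j, ContDiffOn ℝ ∞ (fun y => G y i j) U
  symm : ∀ y i j, G y i j = G y j i
  det_ne_zero : ∀ y ∈ U, (G y).det ≠ 0

theorem contDiffOn_det {ι : Type*} [Fintype ι] [DecidableEq ι] {N : Coord n → Matrix ι ι ℝ}
    {U : Set (Coord n)} (h : ∀ i j, ContDiffOn ℝ ∞ (fun y => N y i j) U) :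
    ContDiffOn ℝ ∞ (fun y => (N y).det) U := by
  simp only [Matrix.det_apply']
  exact ContDiffOn.sum fun σ _ => contDiffOn_const.mul (contDiffOn_prod fun i _ => h _ _)

variable {G : Coord n → Matrix (Fin n) (Fin n) ℝ} {U : Set (Coord n)}

theorem IsMetricOn.contDiffOn_inv (hG : IsMetricOn G U) (i j : Fin n) :
    ContDiffOn ℝ ∞ (fun y => (G y)⁻¹ i j) U := by
  simp only [Matrix.inv_def, Ring.inverse_eq_inv', Matrix.smul_apply, Matrix.adjugate_apply,
    smul_eq_mul]
  refine ((contDiffOn_det hG.smooth).inv hG.det_ne_zero).mul (contDiffOn_det fun k l => ?_)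
  simp only [Matrix.updateRow_apply]
  split_ifs
  · exact contDiffOn_const
  · exact hG.smooth _ _

theorem IsMetricOn.contDiffOn_christoffel (hG : IsMetricOn G U) (f a b : Fin n) :
    ContDiffOn ℝ ∞ (fun y => christoffel G y f a b) U := by
  have h := fun a i j => contDiffOn_partialDeriv hG.isOpen (hG.smooth i j) a
  exact contDiffOn_const.mul (ContDiffOn.sum fun e _ =>
    (hG.contDiffOn_inv _ _).mul (((h _ _ _).add (h _ _ _)).sub (h _ _ _)))

theorem IsMetricOn.christoffel_symm (hG : IsMetricOn G U) (y : Coord n) (f a b : Fin n) :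
    christoffel G y f a b = christoffel G y f b a := by
  have : (fun z => G z a b) = fun z => G z b a := funext fun z => hG.symm z a b
  simp only [christoffel, this]
  congr 1
  refine Finset.sum_congr rfl fun e _ => ?_
  ring

theorem covDeriv_eq (T : Coord n → (Fin p → Fin n) → ℝ) (y : Coord n) (a : Fin n)
    (b : Fin p → Fin n) : covDeriv G T y a b = partialDeriv a (fun z => T z b) y -
      derivAct (fun f c => christoffel G y f a c) (T y) b := rfl

theorem IsMetricOn.contDiffOn_covDeriv (hG : IsMetricOn G U) {T : Coord n → (Fin p → Fin n) → ℝ}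
    (hT : ∀ b, ContDiffOn ℝ ∞ (fun y => T y b) U) (a : Fin n) (b : Fin p → Fin n) :
    ContDiffOn ℝ ∞ (fun y => covDeriv G T y a b) U :=
  (contDiffOn_partialDeriv hG.isOpen (hT b) a).sub <| ContDiffOn.sum fun _ _ =>
    ContDiffOn.sum fun _ _ => (hG.contDiffOn_christoffel _ _ _).mul (hT _)

/-- The covariant derivative treats all slots alike, so it inherits their symmetries. The symmetry
is asked for only on the open set `U`, which suffices for differentiating it there. -/
theorem covDeriv_comp_perm (hU : IsOpen U) {T : Coord n → (Fin p → Fin n) → ℝ}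
    (hT : ∀ b, ContDiffOn ℝ ∞ (fun y => T y b) U) (r : ℝ) (σ : Equiv.Perm (Fin p))
    (hσ : ∀ y ∈ U, ∀ s, T y (s ∘ σ) = r * T y s) {y : Coord n} (hy : y ∈ U) (a : Fin n)
    (s : Fin p → Fin n) : covDeriv G T y a (s ∘ σ) = r * covDeriv G T y a s := by
  rw [covDeriv_eq, covDeriv_eq, derivAct_comp_perm _ _ _ r σ (hσ y hy),
    partialDeriv_congr hU (fun z hz => hσ z hz s) hy,
    partialDeriv_const_mul _ (differentiableAt_of_contDiffOn hU (hT s) hy)]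
  ring

/-- The covariant derivative of a tensor field, as a tensor field with one more index. -/
noncomputable def covDerivField (G : Coord n → Matrix (Fin n) (Fin n) ℝ)
    (T : Coord n → (Fin p → Fin n) → ℝ) (y : Coord n) (s : Fin (p + 1) → Fin n) : ℝ :=
  covDeriv G T y (s 0) (Fin.tail s)

theorem covDeriv_covDerivField (T : Coord n → (Fin p → Fin n) → ℝ) (y : Coord n) (a b : Fin n)
    (s : Fin p → Fin n) :
    covDeriv G (covDerivField G T) y a (Fin.cons b s) =
      partialDeriv a (fun z => covDeriv G T z b s) y
        - ∑ f, christoffel G y f a b * covDeriv G T y f s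
        - derivAct (fun f c => christoffel G y f a c) (covDeriv G T y b) s := by
  rw [covDeriv, Fin.sum_univ_succ]
  have : ∀ i : Fin p, ∀ f, Function.update (Fin.cons b s : Fin (p + 1) → Fin n) i.succ f =
      Fin.cons b (Function.update s i f) := fun i f => (Fin.cons_update _ _ _ _).symm
  simp only [covDerivField, this, Fin.cons_zero, Fin.cons_succ, Fin.tail_cons,
    Fin.update_cons_zero, derivAct]
  ring

theorem IsMetricOn.partialDeriv_covDeriv (hG : IsMetricOn G U) {T : Coord n → (Fin p → Fin n) → ℝ}
    (hT : ∀ b, ContDiffOn ℝ ∞ (fun y => T y b) U) {y : Coord n} (hy : y ∈ U) (a b : Fin n)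
    (s : Fin p → Fin n) :
    partialDeriv a (fun z => covDeriv G T z b s) y =
      partialDeriv a (partialDeriv b fun z => T z s) y
        - derivAct (fun f c => partialDeriv a (fun z => christoffel G z f b c) y) (T y) s
        - derivAct (fun f c => christoffel G y f b c)
            (fun s => partialDeriv a (fun z => T z s) y) s := by
  have hd : ∀ {u : Coord n → ℝ}, ContDiffOn ℝ ∞ u U → DifferentiableAt ℝ u y :=
    fun hu => differentiableAt_of_contDiffOn hG.isOpen hu hy
  have hmul : ∀ i f, ContDiffOn ℝ ∞
      (fun z => christoffel G z f b (s i) * T z (Function.update s i f)) U :=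
    fun i f => (hG.contDiffOn_christoffel _ _ _).mul (hT _)
  simp only [covDeriv]
  rw [partialDeriv_sub (hd (contDiffOn_partialDeriv hG.isOpen (hT s) b))
    (hd (ContDiffOn.sum fun i _ => ContDiffOn.sum fun f _ => hmul i f)), sub_sub]
  congr 1
  rw [partialDeriv_sum fun i => hd (ContDiffOn.sum fun f _ => hmul i f), derivAct, derivAct,
    ← Finset.sum_add_distrib]
  refine Finset.sum_congr rfl fun i _ => ?_
  rw [partialDeriv_sum fun f => hd (hmul i f), ← Finset.sum_add_distrib]
  exact Finset.sum_congr rfl fun f _ =>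
    partialDeriv_mul (hd (hG.contDiffOn_christoffel _ _ _)) (hd (hT _))

/-- The Ricci identity for covariant tensor fields. -/
theorem IsMetricOn.ricci_identity (hG : IsMetricOn G U) {T : Coord n → (Fin p → Fin n) → ℝ}
    (hT : ∀ b, ContDiffOn ℝ ∞ (fun y => T y b) U) {y : Coord n} (hy : y ∈ U) (a b : Fin n)
    (s : Fin p → Fin n) :
    covDeriv G (covDerivField G T) y a (Fin.cons b s)
      - covDeriv G (covDerivField G T) y b (Fin.cons a s) =
      derivAct (fun f c => riemann G y a b c f) (T y) s := by
  have hact : ∀ a b, derivAct (fun f c => christoffel G y f a c) (covDeriv G T y b) s =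
      derivAct (fun f c => christoffel G y f a c) (fun s => partialDeriv b (fun z => T z s) y) s -
      derivAct (fun f c => christoffel G y f a c)
        (derivAct (fun f c => christoffel G y f b c) (T y)) s := by
    intro a b
    simp only [derivAct, covDeriv, mul_sub, Finset.sum_sub_distrib]
  have hriem : derivAct (fun f c => riemann G y a b c f) (T y) s =
      derivAct (fun f c => partialDeriv b (fun z => christoffel G z f a c) y) (T y) s
      - derivAct (fun f c => partialDeriv a (fun z => christoffel G z f b c) y) (T y) s
      + derivAct (fun f c => ∑ e, (christoffel G y f b e * christoffel G y e a c
          - christoffel G y f a e * christoffel G y e b c)) (T y) s := by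
    simp only [derivAct, riemann, add_mul, sub_mul, Finset.sum_sub_distrib, Finset.sum_add_distrib]
  -- Second partial derivatives commute, the terms `Γ · ∂T` are symmetric in `a, b`, and the term
  -- from the slot of the first derivative cancels because the connection is torsion-free. What is
  -- left is `∂Γ` and the commutator of two `Γ` actions.
  rw [covDeriv_covDerivField, covDeriv_covDerivField, hG.partialDeriv_covDeriv hT hy,
    hG.partialDeriv_covDeriv hT hy, hact, hact, hriem, ← derivAct_comm_sub,
    partialDeriv_comm hG.isOpen (hT s) hy a b]
  simp only [hG.christoffel_symm y _ b a]
  ring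

end Connection

/-! ### Symmetries of the curvature tensor and metric compatibility. -/

section Curvature

variable {n : ℕ} {G : Coord n → Matrix (Fin n) (Fin n) ℝ} {U : Set (Coord n)}

theorem IsMetricOn.inv_mul (hG : IsMetricOn G U) {y : Coord n} (hy : y ∈ U) (a b : Fin n) :
    ∑ e, (G y)⁻¹ a e * G y e b = if a = b then 1 else 0 := by
  have := congrFun (congrFun (Matrix.nonsing_inv_mul (G y)
    (isUnit_iff_ne_zero.2 (hG.det_ne_zero y hy))) a) b
  rwa [Matrix.mul_apply, Matrix.one_apply] at this

theorem IsMetricOn.mul_inv (hG : IsMetricOn G U) {y : Coord n} (hy : y ∈ U) (a b : Fin n) :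
    ∑ e, G y a e * (G y)⁻¹ e b = if a = b then 1 else 0 := by
  have := congrFun (congrFun (Matrix.mul_nonsing_inv (G y)
    (isUnit_iff_ne_zero.2 (hG.det_ne_zero y hy))) a) b
  rwa [Matrix.mul_apply, Matrix.one_apply] at this

theorem IsMetricOn.inv_symm (hG : IsMetricOn G U) (y : Coord n) (a b : Fin n) :
    (G y)⁻¹ a b = (G y)⁻¹ b a := by
  have h : (G y).transpose = G y := Matrix.ext fun i j => hG.symm y j i
  have h' := Matrix.transpose_nonsing_inv (G y)
  rw [h] at h'
  exact (congrFun (congrFun h' b) a)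

theorem IsMetricOn.sum_christoffel_mul (hG : IsMetricOn G U) {y : Coord n} (hy : y ∈ U)
    (a b c : Fin n) : ∑ f, christoffel G y f a b * G y f c =
      (1 / 2) * (partialDeriv a (fun z => G z c b) y + partialDeriv b (fun z => G z c a) y
      - partialDeriv c (fun z => G z a b) y) := by
  simp only [christoffel, mul_assoc, ← Finset.mul_sum, Finset.sum_mul]
  rw [Finset.sum_comm]
  congr 1
  have : ∀ e (D : ℝ), ∑ f, (G y)⁻¹ f e * (D * G y f c) = if e = c then D else 0 := fun e D => by
    rw [← mul_boole, ← hG.inv_mul hy, Finset.mul_sum]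
    exact Finset.sum_congr rfl fun f _ => by rw [hG.inv_symm y f e]; ring
  simp only [this, Finset.sum_ite_eq', Finset.mem_univ, if_true]

/-- The Levi-Civita connection is compatible with the metric. -/
theorem IsMetricOn.covDeriv_metric (hG : IsMetricOn G U) {y : Coord n} (hy : y ∈ U) (a : Fin n)
    (s : Fin 2 → Fin n) : covDeriv G (fun z s => G z (s 0) (s 1)) y a s = 0 := by
  have h : ∀ i j, (fun z => G z i j) = fun z => G z j i := fun i j => funext fun z => hG.symm z i j
  simp only [covDeriv, Fin.sum_univ_two, Function.update_self, ne_eq, one_ne_zero,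
    not_false_eq_true, Function.update_of_ne, zero_ne_one]
  simp only [hG.symm y (s 0), hG.sum_christoffel_mul hy, h _ a, h (s 1) (s 0)]
  ring

theorem covDeriv_of_eqOn_zero {p : ℕ} (hU : IsOpen U) {T : Coord n → (Fin p → Fin n) → ℝ}
    (hT : ∀ y ∈ U, ∀ s, T y s = 0) {y : Coord n} (hy : y ∈ U) (a : Fin n) (s : Fin p → Fin n) :
    covDeriv G T y a s = 0 := by
  rw [covDeriv_eq, partialDeriv_congr hU (v := fun _ => 0) (fun z hz => hT z hz s) hy]
  simp [partialDeriv, derivAct, hT y hy]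

theorem riemann_antisymm (y : Coord n) (a b c f : Fin n) :
    riemann G y a b c f = - riemann G y b a c f := by
  simp only [riemann, Finset.sum_sub_distrib]
  ring

theorem riemannLow_antisymm_left (y : Coord n) (a b c d : Fin n) :
    riemannLow G y a b c d = - riemannLow G y b a c d := by
  simp only [riemannLow, riemann_antisymm y a b, neg_mul, Finset.sum_neg_distrib]

theorem IsMetricOn.riemann_bianchi (hG : IsMetricOn G U) (y : Coord n) (a b c f : Fin n) :
    riemann G y a b c f + riemann G y b c a f + riemann G y c a b f = 0 := by
  have h : ∀ f a b, (fun z => christoffel G z f a b) = fun z => christoffel G z f b a :=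
    fun f a b => funext fun z => hG.christoffel_symm z f a b
  simp only [riemann, Finset.sum_sub_distrib, hG.christoffel_symm y _ b a,
    hG.christoffel_symm y _ c b, hG.christoffel_symm y _ c a, h _ b a, h _ c b, h _ c a]
  ring

theorem IsMetricOn.riemannLow_bianchi (hG : IsMetricOn G U) (y : Coord n) (a b c d : Fin n) :
    riemannLow G y a b c d + riemannLow G y b c a d + riemannLow G y c a b d = 0 := by
  simp only [riemannLow, ← Finset.sum_add_distrib, ← add_mul, hG.riemann_bianchi, zero_mul,
    Finset.sum_const_zero]

/-- The metric is parallel on all of `U`, so its second covariant derivatives vanish and the Ricci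
identity applied to it reads `R_{abcd} + R_{abdc} = 0`. -/
theorem IsMetricOn.riemannLow_antisymm_right (hG : IsMetricOn G U) {y : Coord n} (hy : y ∈ U)
    (a b c d : Fin n) : riemannLow G y a b c d = - riemannLow G y a b d c := by
  have h := hG.ricci_identity (T := fun z s => G z (s 0) (s 1)) (fun _ => hG.smooth _ _) hy a b
    ![c, d]
  have h0 : ∀ z ∈ U, ∀ s, covDerivField G (fun z (s : Fin 2 → Fin n) => G z (s 0) (s 1)) z s = 0 :=
    fun z hz s => hG.covDeriv_metric hz _ _
  rw [covDeriv_of_eqOn_zero hG.isOpen h0 hy, covDeriv_of_eqOn_zero hG.isOpen h0 hy] at h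
  simp only [derivAct, Fin.sum_univ_two, Function.update_self, ne_eq, one_ne_zero,
    not_false_eq_true, Function.update_of_ne, zero_ne_one, Matrix.cons_val_zero,
    Matrix.cons_val_one, hG.symm y c] at h
  simp only [riemannLow]
  linarith

theorem IsMetricOn.sum_riemannLow_mul_inv (hG : IsMetricOn G U) {y : Coord n} (hy : y ∈ U)
    (a b c f : Fin n) : ∑ e, riemannLow G y a b c e * (G y)⁻¹ e f = riemann G y a b c f := by
  simp only [riemannLow, Finset.sum_mul, mul_assoc]
  rw [Finset.sum_comm]
  simp only [← Finset.mul_sum, hG.mul_inv hy, mul_ite, mul_one, mul_zero, Finset.sum_ite_eq',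
    Finset.mem_univ, if_true]

end Curvature

/-! ### Skew-symmetric arrays and their slot exchanges. -/

section Skew

variable {n m k : ℕ}

/-- Total skew-symmetry of a function of a multi-index. -/
def IsSkew (T : (Fin m → Fin n) → ℝ) : Prop :=
  ∀ (σ : Equiv.Perm (Fin m)) (s : Fin m → Fin n), T (s ∘ σ) = ((Equiv.Perm.sign σ : ℤ) : ℝ) * T s

theorem IsSkew.swap {T : (Fin m → Fin n) → ℝ} (hT : IsSkew T) {i j : Fin m} (hij : i ≠ j)
    {s t : Fin m → Fin n} (h : t = s ∘ Equiv.swap i j) : T t = - T s := by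
  rw [h, hT, Equiv.Perm.sign_swap hij]
  simp

theorem IsSkew.eq_zero {T : (Fin m → Fin n) → ℝ} (hT : IsSkew T) {i j : Fin m} (hij : i ≠ j)
    {s : Fin m → Fin n} (h : s i = s j) : T s = 0 := by
  have := hT.swap hij (s := s) (t := s) (by
    funext l
    simp only [Function.comp_apply, Equiv.swap_apply_def]
    split_ifs with h1 h2 <;> simp_all)
  linarith

theorem IsSkew.eq_zero_of_lt {T : (Fin m → Fin n) → ℝ} (hT : IsSkew T) (h : n < m)
    (s : Fin m → Fin n) : T s = 0 := by
  obtain ⟨i, j, hij, hs⟩ := Fintype.exists_ne_map_eq_of_card_lt s (by simpa using h)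
  exact hT.eq_zero hij hs

theorem isSkew_antisymm (T : (Fin m → Fin n) → ℝ) : IsSkew (antisymm T) := by
  intro σ s
  simp only [antisymm]
  rw [mul_left_comm]
  congr 1
  rw [Finset.mul_sum]
  refine Fintype.sum_equiv (Equiv.mulLeft σ) _ _ fun τ => ?_
  have h : ((Equiv.Perm.sign σ : ℤ) : ℝ) * ((Equiv.Perm.sign σ : ℤ) : ℝ) = 1 := by
    rw [← Int.cast_mul, ← Units.val_mul, Int.units_mul_self]; simp
  simp only [Equiv.coe_mulLeft, Equiv.Perm.sign_mul, Units.val_mul, Int.cast_mul,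
    Equiv.Perm.coe_mul, Function.comp_apply]
  rw [mul_assoc, ← mul_assoc, h, one_mul]

theorem antisymm_three (T : (Fin 3 → Fin n) → ℝ) (a b c : Fin n) :
    antisymm T ![a, b, c] = (1 / 6) * (T ![a, b, c] + T ![b, c, a] + T ![c, a, b]
      - T ![b, a, c] - T ![a, c, b] - T ![c, b, a]) := by
  have huniv : (Finset.univ : Finset (Equiv.Perm (Fin 3))) =
      {1, finRotate 3, (finRotate 3)⁻¹, Equiv.swap 0 1, Equiv.swap 1 2, Equiv.swap 0 2} := by
    decide
  have hs : ∀ σ : Equiv.Perm (Fin 3), (fun i => ![a, b, c] (σ i)) =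
      ![![a, b, c] (σ 0), ![a, b, c] (σ 1), ![a, b, c] (σ 2)] := by
    intro σ; funext i; fin_cases i <;> rfl
  rw [antisymm, huniv]
  rw [Finset.sum_insert (by decide), Finset.sum_insert (by decide), Finset.sum_insert (by decide),
    Finset.sum_insert (by decide), Finset.sum_insert (by decide), Finset.sum_singleton]
  simp only [hs]
  have e1 : Equiv.Perm.sign (finRotate 3) = 1 := by decide
  have e2 : Equiv.Perm.sign (finRotate 3)⁻¹ = 1 := by decide
  have e3 : Equiv.Perm.sign (Equiv.swap (0 : Fin 3) 1) = -1 := by decide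
  have e4 : Equiv.Perm.sign (Equiv.swap (1 : Fin 3) 2) = -1 := by decide
  have e5 : Equiv.Perm.sign (Equiv.swap (0 : Fin 3) 2) = -1 := by decide
  have f1 : (finRotate 3) 0 = 1 ∧ (finRotate 3) 1 = 2 ∧ (finRotate 3) 2 = 0 := by decide
  have f2 : (finRotate 3)⁻¹ 0 = 2 ∧ (finRotate 3)⁻¹ 1 = 0 ∧ (finRotate 3)⁻¹ 2 = 1 := by decide
  have f3 : (Equiv.swap (0 : Fin 3) 1) 2 = 2 := by decide
  have f4 : (Equiv.swap (1 : Fin 3) 2) 0 = 0 := by decide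
  have f5 : (Equiv.swap (0 : Fin 3) 2) 1 = 1 := by decide
  simp only [e1, e2, e3, e4, e5, f1, f2, f3, f4, f5, Equiv.swap_apply_left,
    Equiv.swap_apply_right, Equiv.Perm.sign_one, Equiv.Perm.one_apply, Matrix.cons_val_zero,
    Matrix.cons_val_one, Matrix.cons_val_two, Units.val_one, Units.val_neg,
    Int.cast_one, Int.cast_neg]
  norm_num [Nat.factorial]
  ring

variable {A : (Fin (k + 2) → Fin n) → ℝ}

theorem IsSkew.idx_swap (hA : IsSkew A) (c d : Fin n) (E : Fin k → Fin n) :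
    A (idx c d E) = - A (idx d c E) := by
  refine hA.swap (i := 0) (j := 1) (by simp) (funext fun l => ?_)
  refine Fin.cases ?_ (fun l => Fin.cases ?_ (fun l => ?_) l) l
  · simp [idx]
  · simp [idx]
  · rw [Function.comp_apply, Equiv.swap_apply_of_ne_of_ne (Fin.succ_ne_zero _)
      (by simp [Fin.ext_iff])]
    simp [idx]

theorem IsSkew.idx_update_swap (hA : IsSkew A) (c d f : Fin n) (E : Fin k → Fin n) (i : Fin k) :
    A (idx c d (Function.update E i f)) = - A (idx f d (Function.update E i c)) := by
  refine hA.swap (i := 0) (j := i.succ.succ) (Fin.succ_ne_zero _).symm (funext fun l => ?_)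
  have h0 : ∀ (c d : Fin n) (E : Fin k → Fin n), idx c d E 0 = c := fun _ _ _ => rfl
  have h2 : ∀ (c d : Fin n) (E : Fin k → Fin n) (l : Fin k), idx c d E l.succ.succ = E l :=
    fun _ _ _ _ => rfl
  refine Fin.cases ?_ (fun l => Fin.cases ?_ (fun l => ?_) l) l
  · rw [Function.comp_apply, Equiv.swap_apply_left, h0, h2, Function.update_self]
  · rw [Function.comp_apply, Equiv.swap_apply_of_ne_of_ne (Fin.succ_ne_zero _)
      (by simp [Fin.ext_iff])]
    rfl
  · by_cases h : l = i
    · subst h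
      rw [Function.comp_apply, Equiv.swap_apply_right, h0, h2, Function.update_self]
    · rw [Function.comp_apply, Equiv.swap_apply_of_ne_of_ne (Fin.succ_ne_zero _)
        (by simpa using h), h2, h2, Function.update_of_ne h, Function.update_of_ne h]

theorem derivAct_idx (X : Fin n → Fin n → ℝ) (A : (Fin (k + 2) → Fin n) → ℝ) (c d : Fin n)
    (E : Fin k → Fin n) :
    derivAct X A (idx c d E) = ∑ f, X f c * A (idx f d E) + ∑ f, X f d * A (idx c f E)
      + ∑ i, ∑ f, X f (E i) * A (idx c d (Function.update E i f)) := by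
  rw [derivAct, Fin.sum_univ_succ, Fin.sum_univ_succ, ← add_assoc]
  have h0 : ∀ f, Function.update (idx c d E) 0 f = idx f d E := fun f => by
    rw [idx, Fin.update_cons_zero]; rfl
  have h1 : ∀ f, Function.update (idx c d E) (Fin.succ 0) f = idx c f E := fun f => by
    rw [idx, ← Fin.cons_update, Fin.update_cons_zero]; rfl
  have h2 : ∀ (i : Fin k) f, Function.update (idx c d E) i.succ.succ f =
      idx c d (Function.update E i f) := fun i f => by
    rw [idx, ← Fin.cons_update, ← Fin.cons_update]; rfl
  simp only [h0, h1, h2]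
  rfl

end Skew

/-! ### Algebraic integrability condition of the Killing–Yano equation. -/

section Integrability

variable {n p k : ℕ} {G : Coord n → Matrix (Fin n) (Fin n) ℝ} {U : Set (Coord n)}

/-- The Killing-Yano equation in one coordinate system. -/
structure IsKillingYanoOn (G : Coord n → Matrix (Fin n) (Fin n) ℝ)
    (A : Coord n → (Fin p → Fin n) → ℝ) (U : Set (Coord n)) : Prop where
  smooth : ∀ b, ContDiffOn ℝ ∞ (fun y => A y b) U
  skew : ∀ y, IsSkew (A y)
  killingYano : ∀ y ∈ U, ∀ s, covDerivField G A y s = antisymm (covDerivField G A y) s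

/-- The equation makes `∇A` equal to its antisymmetrization throughout `U`, and one more covariant
derivative preserves this skewness. -/
theorem IsKillingYanoOn.isSkew_covDeriv (hG : IsMetricOn G U)
    {A : Coord n → (Fin p → Fin n) → ℝ} (hA : IsKillingYanoOn G A U) {y : Coord n} (hy : y ∈ U)
    (a : Fin n) : IsSkew (covDeriv G (covDerivField G A) y a) := by
  intro σ s
  refine covDeriv_comp_perm hG.isOpen (fun b => hG.contDiffOn_covDeriv hA.smooth _ _) _ σ
    (fun z hz s => ?_) hy a s
  change covDerivField G A z (s ∘ σ) = _ * covDerivField G A z s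
  rw [hA.killingYano z hz, hA.killingYano z hz s]
  exact isSkew_antisymm _ σ s

/-- The algebraic integrability condition of the Killing-Yano equation. -/
theorem IsKillingYanoOn.integrability (hG : IsMetricOn G U)
    {A : Coord n → (Fin (k + 2) → Fin n) → ℝ} (hA : IsKillingYanoOn G A U) {y : Coord n}
    (hy : y ∈ U) (a b c d : Fin n) (E : Fin k → Fin n) :
    derivAct (fun f e => riemann G y a b e f) (A y) (idx c d E)
      + derivAct (fun f e => riemann G y c d e f) (A y) (idx a b E) =
    derivAct (fun f e => riemann G y a d e f) (A y) (idx b c E)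
      + derivAct (fun f e => riemann G y b c e f) (A y) (idx a d E) := by
  simp only [← hG.ricci_identity hA.smooth hy]
  -- `h` and `h'` exchange the first index of `∇A` with its second and third. These exchanges bring
  -- both sides to the same alternating sum of `∇_a B_{bcdE}`.
  have h : ∀ a b c d : Fin n,
      covDeriv G (covDerivField G A) y a (Fin.cons b (idx c d E)) =
        - covDeriv G (covDerivField G A) y a (Fin.cons c (idx b d E)) := fun a b c d =>
    (hA.isSkew_covDeriv hG hy a).idx_swap b c (Fin.cons d E)
  have h' : ∀ a b c d : Fin n,
      covDeriv G (covDerivField G A) y a (Fin.cons b (idx c d E)) =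
        - covDeriv G (covDerivField G A) y a (Fin.cons d (idx c b E)) := fun a b c d => by
    have idx_cons : ∀ b c d : Fin n, idx b c (Fin.cons d E : Fin (k + 1) → Fin n) =
      Fin.cons b (idx c d E) := fun _ _ _ => rfl
    have := (hA.isSkew_covDeriv hG hy a).idx_update_swap b c d (Fin.cons b E : Fin (k + 1) → _) 0
    rwa [Fin.update_cons_zero, Fin.update_cons_zero, idx_cons, idx_cons] at this
  linarith [h' a d b c, h a c b d, h b a c d, h' c d a b, h' d c a b, h d b a c]

end Integrability

/-! ### The Riemann identity. -/

section Symmetries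

variable {n k : ℕ} {G : Coord n → Matrix (Fin n) (Fin n) ℝ} {U : Set (Coord n)}

/-- The classical octahedron argument: four instances of the Bianchi identity, combined using
skewness in each pair. -/
theorem IsMetricOn.riemannLow_pair (hG : IsMetricOn G U) {y : Coord n} (hy : y ∈ U)
    (a b c d : Fin n) : riemannLow G y a b c d = riemannLow G y c d a b := by
  have l := riemannLow_antisymm_left (G := G) y
  have r := hG.riemannLow_antisymm_right hy
  have B := hG.riemannLow_bianchi y
  linarith [B a b c d, B b c d a, B c d a b, B d a b c, l a b c d, r a b c d, l c d a b, r c d a b,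
    l b c a d, r b c a d, l c a b d, r c a b d, l a d b c, r a d b c, l b d a c, r b d a c,
    l b c d a, l c d b a, r c d b a, l d b c a, r d b c a, l d a c b, r d a c b, l a c d b,
    l d a b c, l a b d c, l b d a c, r c a d b, l a c b d, l d b a c, r a c b d, r a c d b]

theorem IsMetricOn.riemannUp_eq (hG : IsMetricOn G U) {y : Coord n} (hy : y ∈ U)
    (f a b c : Fin n) : riemannUp G y f a b c = - riemann G y b c a f := by
  rw [← hG.sum_riemannLow_mul_inv hy, riemannUp, ← Finset.sum_neg_distrib]
  refine Finset.sum_congr rfl fun e _ => ?_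
  rw [hG.inv_symm y f e, hG.riemannLow_pair hy, hG.riemannLow_antisymm_right hy]
  ring

theorem IsMetricOn.derivAct_riemann (hG : IsMetricOn G U) {y : Coord n} (hy : y ∈ U)
    {A : (Fin (k + 2) → Fin n) → ℝ} (hA : IsSkew A) (a b c d : Fin n) (E : Fin k → Fin n) :
    derivAct (fun f e => riemann G y a b e f) A (idx c d E) =
      ∑ f, riemannUp G y f c a b * A (idx d f E) - ∑ f, riemannUp G y f d a b * A (idx c f E)
      - hatRiemann (riemannUp G y) A E a b c d := by
  simp only [derivAct_idx, hatRiemann, hG.riemannUp_eq hy, hA.idx_swap _ d E, neg_mul, mul_neg,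
    Finset.sum_neg_distrib]
  ring

theorem IsKillingYanoOn.riemann_identity (hG : IsMetricOn G U)
    {A : Coord n → (Fin (k + 2) → Fin n) → ℝ} (hA : IsKillingYanoOn G A U) {y : Coord n}
    (hy : y ∈ U) (a b c d : Fin n) (E : Fin k → Fin n) :
    (0 : ℝ) =
        ∑ f, riemannUp G y f a c b * A y (idx d f E)
          + ∑ f, riemannUp G y f b d a * A y (idx c f E)
          + ∑ f, riemannUp G y f c a d * A y (idx b f E)
          + ∑ f, riemannUp G y f d b c * A y (idx a f E)
          + antisymm (fun s => hatRiemann (riemannUp G y) (A y) E (s 0) (s 1) (s 2) a) ![b, c, d]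
          + 2 * antisymm (fun s => hatRiemann (riemannUp G y) (A y) E a (s 0) (s 1) (s 2)) ![b, c, d]
          + 2 * hatRiemann (riemannUp G y) (A y) E b c a d
          - 3 * antisymm (fun s => hatRiemann (riemannUp G y) (A y) E (s 0) (s 1) (s 2) d)
              ![a, b, c] := by
  simp only [antisymm_three, Matrix.cons_val_zero, Matrix.cons_val_one, Matrix.cons_val]
  have hM1 : ∀ x u v w, ∑ f, riemannUp G y f x u v * A y (idx w f E) =
      - ∑ f, riemannUp G y f x v u * A y (idx w f E) := fun x u v w => by
    rw [← Finset.sum_neg_distrib]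
    refine Finset.sum_congr rfl fun f _ => ?_
    rw [hG.riemannUp_eq hy, hG.riemannUp_eq hy, riemann_antisymm]; ring
  have hM2 : ∀ x u v w, ∑ f, riemannUp G y f x u v * A y (idx w f E)
      + ∑ f, riemannUp G y f u v x * A y (idx w f E)
      + ∑ f, riemannUp G y f v x u * A y (idx w f E) = 0 := fun x u v w => by
    rw [← Finset.sum_add_distrib, ← Finset.sum_add_distrib]
    refine Finset.sum_eq_zero fun f _ => ?_
    simp only [hG.riemannUp_eq hy]
    linear_combination (- A y (idx w f E)) * hG.riemann_bianchi y u v x f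
  have hH1 : ∀ u v w x, hatRiemann (riemannUp G y) (A y) E u v w x =
      - hatRiemann (riemannUp G y) (A y) E v u w x := fun u v w x => by
    simp only [hatRiemann, hG.riemannUp_eq hy, riemann_antisymm y v u, neg_mul,
      Finset.sum_neg_distrib, neg_neg]
  have hH2 : ∀ u v w x, hatRiemann (riemannUp G y) (A y) E u v w x =
      - hatRiemann (riemannUp G y) (A y) E u v x w := fun u v w x => by
    simp only [hatRiemann, (hA.skew y).idx_swap x w, mul_neg, Finset.sum_neg_distrib, neg_neg]
  -- These are `P₁ = P₃` and `P₂ = P₁`; together they say that all three pairings agree.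
  have i1 := hA.integrability hG hy a b c d E
  have i2 := hA.integrability hG hy a c d b E
  simp only [hG.derivAct_riemann hy (hA.skew y)] at i1 i2
  -- From here the sums are opaque arrays known only through their symmetries, and the claim is
  -- linear in them.
  generalize hM : (fun x u v w => ∑ f, riemannUp G y f x u v * A y (idx w f E)) = M at *
  generalize hH : hatRiemann (riemannUp G y) (A y) E = H at *
  have hM' : ∀ x u v w, ∑ f, riemannUp G y f x u v * A y (idx w f E) = M x u v w :=
    fun x u v w => by rw [← hM]
  simp only [hM'] at *
  linarith [hM1 b c d a, hM1 c d b a, hM1 d b c a, hM2 b c d a, hM1 a c d b, hM1 c d a b, hM1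
    d a c b, hM2 a c d b, hM1 a b d c, hM1 b d a c, hM1 d a b c, hM2 a b d c, hM1 a b c d, hM1
    b c a d, hM1 c a b d, hM2 a b c d, hH1 a b c d, hH2 a b c d, hH1 a b d c, hH1 a c b d, hH2
    a c b d, hH1 a c d b, hH1 a d b c, hH2 a d b c, hH1 a d c b, hH1 b c a d, hH2 b c a d, hH1
    b c d a, hH1 b d a c, hH2 b d a c, hH1 b d c a, hH1 c d a b, hH2 c d a b, hH1 c d b a, i1,
    i2]

end Symmetries

/-! ### Traces, the Weyl tensor and the Ricci identity for `A`. -/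

section Contraction

variable {n k : ℕ} {G : Coord n → Matrix (Fin n) (Fin n) ℝ} {U : Set (Coord n)}

/-- The components `Q^{ae}`, the indices being raised with the matrix `h`. -/
def raise (h : Matrix (Fin n) (Fin n) ℝ) (Q : Fin n → Fin n → ℝ) (a e : Fin n) : ℝ :=
  ∑ b, ∑ f, h a b * h e f * Q b f

theorem raise_antisymm (h : Matrix (Fin n) (Fin n) ℝ) {Q : Fin n → Fin n → ℝ}
    (hQ : ∀ a b, Q a b = - Q b a) (a e : Fin n) : raise h Q a e = - raise h Q e a := by
  rw [raise, raise, Finset.sum_comm, ← Finset.sum_neg_distrib]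
  refine Finset.sum_congr rfl fun b _ => ?_
  rw [← Finset.sum_neg_distrib]
  refine Finset.sum_congr rfl fun f _ => ?_
  rw [hQ]; ring

theorem sum_rotate {α β γ : Type*} [Fintype α] [Fintype β] [Fintype γ] (F : α → β → γ → ℝ) :
    ∑ a, ∑ b, ∑ c, F a b c = ∑ c, ∑ a, ∑ b, F a b c :=
  (Finset.sum_congr rfl fun _ _ => Finset.sum_comm).trans Finset.sum_comm

theorem sum_comm_pairs {α β γ δ : Type*} [Fintype α] [Fintype β] [Fintype γ] [Fintype δ]
    (F : α → β → γ → δ → ℝ) :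
    ∑ a, ∑ b, ∑ c, ∑ d, F a b c d = ∑ c, ∑ d, ∑ a, ∑ b, F a b c d :=
  (sum_rotate fun a b c => ∑ d, F a b c d).trans (Finset.sum_congr rfl fun c _ =>
    sum_rotate fun a b d => F a b c d)

theorem sum_mul_antisymm_swap (S : Fin n → Fin n → ℝ) {W : Fin n → Fin n → ℝ}
    (hW : ∀ a b, W a b = - W b a) :
    ∑ a, ∑ b, S b a * W a b = - ∑ a, ∑ b, S a b * W a b := by
  rw [Finset.sum_comm, ← Finset.sum_neg_distrib]
  refine Finset.sum_congr rfl fun b _ => ?_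
  rw [← Finset.sum_neg_distrib]
  exact Finset.sum_congr rfl fun f _ => by rw [hW]; ring

theorem IsMetricOn.sum_mul_raise (hG : IsMetricOn G U) {y : Coord n} (hy : y ∈ U)
    (Q : Fin n → Fin n → ℝ) (e x : Fin n) :
    ∑ a, G y e a * raise (G y)⁻¹ Q a x = ∑ f, (G y)⁻¹ x f * Q e f := by
  have : ∑ a, G y e a * raise (G y)⁻¹ Q a x =
      ∑ b, (∑ a, G y e a * (G y)⁻¹ a b) * ∑ f, (G y)⁻¹ x f * Q b f := by
    simp only [raise, Finset.sum_mul, Finset.mul_sum]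
    rw [Finset.sum_comm]
    refine Finset.sum_congr rfl fun b _ => Finset.sum_comm.trans ?_
    exact Finset.sum_congr rfl fun f _ => Finset.sum_congr rfl fun a _ => by ring
  rw [this]
  simp [hG.mul_inv hy]

theorem IsMetricOn.sum_raise_mul_ricci (hG : IsMetricOn G U) {y : Coord n} (hy : y ∈ U)
    (Q : Fin n → Fin n → ℝ) (e c : Fin n) :
    ∑ a, ∑ x, G y a e * ricci G y x c * raise (G y)⁻¹ Q a x = ∑ f, ricciUp G y f c * Q e f := by
  have : ∀ x, ∑ a, G y a e * ricci G y x c * raise (G y)⁻¹ Q a x =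
      ∑ f, ricci G y x c * ((G y)⁻¹ x f * Q e f) := fun x => by
    rw [← Finset.mul_sum, ← hG.sum_mul_raise hy, Finset.mul_sum]
    exact Finset.sum_congr rfl fun a _ => by rw [hG.symm y a e]; ring
  rw [Finset.sum_comm]
  simp only [this]
  rw [Finset.sum_comm]
  refine Finset.sum_congr rfl fun f _ => ?_
  rw [ricciUp, Finset.sum_mul]
  exact Finset.sum_congr rfl fun x _ => by rw [hG.inv_symm y f x]; ring

theorem IsMetricOn.sum_mul_mul_raise (hG : IsMetricOn G U) {y : Coord n} (hy : y ∈ U)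
    (Q : Fin n → Fin n → ℝ) (e c : Fin n) :
    ∑ a, ∑ x, G y a e * G y x c * raise (G y)⁻¹ Q a x = Q e c := by
  have : ∀ x, ∑ a, G y a e * G y x c * raise (G y)⁻¹ Q a x =
      ∑ f, G y c x * ((G y)⁻¹ x f * Q e f) := fun x => by
    rw [← Finset.mul_sum, ← hG.sum_mul_raise hy, Finset.mul_sum]
    exact Finset.sum_congr rfl fun a _ => by rw [hG.symm y a e, hG.symm y x c]; ring
  rw [Finset.sum_comm]
  simp only [this]
  rw [Finset.sum_comm]
  simp only [← mul_assoc, ← Finset.sum_mul, hG.mul_inv hy]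
  simp

/-- Against a skew `Q` the four metric–Ricci products in the Weyl tensor agree in pairs, as do the
two metric products; hence the factors `2`. -/
theorem IsMetricOn.sum_weyl_mul_raise (hG : IsMetricOn G U) {y : Coord n} (hy : y ∈ U)
    {Q : Fin n → Fin n → ℝ} (hQ : ∀ a b, Q a b = - Q b a) (e c : Fin n) :
    ∑ a, ∑ x, weyl G y a x e c * raise (G y)⁻¹ Q a x =
      ∑ a, ∑ x, riemannLow G y a x e c * raise (G y)⁻¹ Q a x
      - 2 / ((n : ℝ) - 2) * (∑ f, ricciUp G y f c * Q e f - ∑ f, ricciUp G y f e * Q c f)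
      + 2 * (scalarCurv G y / (((n : ℝ) - 1) * ((n : ℝ) - 2))) * Q e c := by
  have hW := raise_antisymm (G y)⁻¹ hQ
  have h1 := hG.sum_raise_mul_ricci hy Q e c
  have h2 := hG.sum_raise_mul_ricci hy Q c e
  have h3 := sum_mul_antisymm_swap (fun a x => G y a e * ricci G y x c) hW
  have h4 := sum_mul_antisymm_swap (fun a x => G y a c * ricci G y x e) hW
  have h5 := hG.sum_mul_mul_raise hy Q e c
  have h6 := hG.sum_mul_mul_raise hy Q c e
  rw [h1] at h3
  rw [h2] at h4
  have hexp : ∑ a, ∑ x, weyl G y a x e c * raise (G y)⁻¹ Q a x =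
      ∑ a, ∑ x, riemannLow G y a x e c * raise (G y)⁻¹ Q a x
      - (1 / ((n : ℝ) - 2)) * (∑ a, ∑ x, G y a e * ricci G y x c * raise (G y)⁻¹ Q a x
        - ∑ a, ∑ x, G y a c * ricci G y x e * raise (G y)⁻¹ Q a x
        - ∑ a, ∑ x, G y x e * ricci G y a c * raise (G y)⁻¹ Q a x
        + ∑ a, ∑ x, G y x c * ricci G y a e * raise (G y)⁻¹ Q a x)
      + (scalarCurv G y / (((n : ℝ) - 1) * ((n : ℝ) - 2))) *
        (∑ a, ∑ x, G y a e * G y x c * raise (G y)⁻¹ Q a x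
          - ∑ a, ∑ x, G y a c * G y x e * raise (G y)⁻¹ Q a x) := by
    simp only [Finset.mul_sum, ← Finset.sum_sub_distrib, ← Finset.sum_add_distrib]
    exact Finset.sum_congr rfl fun a _ => Finset.sum_congr rfl fun x _ => by rw [weyl]; ring
  rw [hexp, h1, h2, h3, h4, h5, h6, hQ c e]
  ring

theorem IsMetricOn.sum_weylUp (hG : IsMetricOn G U) (y : Coord n)
    (Q : Fin n → Fin n → ℝ) (e c : Fin n) :
    ∑ a, ∑ f, weylUp G y a f e c * Q a f =
      ∑ a, ∑ x, weyl G y a x e c * raise (G y)⁻¹ Q a x := by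
  simp only [weylUp, raise, Finset.sum_mul, Finset.mul_sum]
  rw [sum_comm_pairs]
  refine Finset.sum_congr rfl fun e _ => Finset.sum_congr rfl fun g _ =>
    Finset.sum_congr rfl fun a _ => Finset.sum_congr rfl fun f _ => ?_
  rw [hG.inv_symm y a, hG.inv_symm y f]
  ring

theorem IsMetricOn.sum_inv_mul_riemann (hG : IsMetricOn G U) {y : Coord n} (hy : y ∈ U)
    (Q : Fin n → Fin n → ℝ) (c d : Fin n) :
    ∑ a, ∑ b, (G y)⁻¹ a b * ∑ f, riemann G y c a d f * Q b f =
      ∑ a, ∑ e, riemannLow G y c a d e * raise (G y)⁻¹ Q a e := by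
  simp only [← hG.sum_riemannLow_mul_inv hy, raise, Finset.sum_mul, Finset.mul_sum]
  refine Finset.sum_congr rfl fun a _ => (sum_rotate _).trans ?_
  exact Finset.sum_congr rfl fun e _ => Finset.sum_congr rfl fun b _ =>
    Finset.sum_congr rfl fun f _ => by ring

theorem IsMetricOn.sum_inv_riemann_eq_ricciUp (hG : IsMetricOn G U) {y : Coord n} (hy : y ∈ U)
    (c f : Fin n) : ∑ a, ∑ b, (G y)⁻¹ a b * riemann G y c a b f = - ricciUp G y f c := by
  simp only [← hG.sum_riemannLow_mul_inv hy, ricciUp, ricci, riemannUp, Finset.mul_sum,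
    ← Finset.sum_neg_distrib]
  rw [sum_rotate]
  refine Finset.sum_congr rfl fun e _ => Finset.sum_congr rfl fun a _ =>
    Finset.sum_congr rfl fun b _ => ?_
  rw [hG.riemannLow_pair hy b e a c, riemannLow_antisymm_left y a c, hG.inv_symm y e f]
  ring

/-- Contraction with a skew-symmetric tensor of the first Bianchi identity. -/
theorem IsMetricOn.two_mul_sum_riemannLow (hG : IsMetricOn G U) {y : Coord n} (hy : y ∈ U)
    {W : Fin n → Fin n → ℝ} (hW : ∀ a b, W a b = - W b a) (c e : Fin n) :
    2 * ∑ a, ∑ x, riemannLow G y c a e x * W a x =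
      - ∑ a, ∑ x, riemannLow G y a x e c * W a x := by
  have h := sum_mul_antisymm_swap (fun a x => riemannLow G y c a e x) hW
  have : ∑ a, ∑ x, riemannLow G y a x e c * W a x =
      ∑ a, ∑ x, riemannLow G y c x e a * W a x - ∑ a, ∑ x, riemannLow G y c a e x * W a x := by
    -- Termwise this is Bianchi in the form `R_{axec} = R_{cxea} - R_{caex}`; the two contractions
    -- on the right are opposite by skewness of `W`.
    simp only [← Finset.sum_sub_distrib, ← sub_mul]
    refine Finset.sum_congr rfl fun a _ => Finset.sum_congr rfl fun x _ => ?_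
    congr 1
    linarith [hG.riemannLow_bianchi y c a e x, hG.riemannLow_pair hy c x e a,
      riemannLow_antisymm_left (G := G) y a e c x, hG.riemannLow_pair hy a x e c,
      hG.riemannLow_antisymm_right hy e a c x]
  rw [this, h]
  ring

/-- Pair symmetry turns exchanging `c, d` into exchanging `a, x`. Hence this part of the trace drops
out on symmetrization. -/
theorem IsMetricOn.sum_riemannLow_symm (hG : IsMetricOn G U) {y : Coord n} (hy : y ∈ U)
    {W : Fin n → Fin n → ℝ} (hW : ∀ a b, W a b = - W b a) (c d : Fin n) :
    ∑ a, ∑ x, riemannLow G y d a c x * W a x = - ∑ a, ∑ x, riemannLow G y c a d x * W a x := by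
  rw [← sum_mul_antisymm_swap _ hW]
  exact Finset.sum_congr rfl fun a _ => Finset.sum_congr rfl fun x _ => by
    rw [hG.riemannLow_pair hy]

/-- The trace `g^{ab} (∇_c ∇_a - ∇_a ∇_c) A_{bdE}`. -/
noncomputable def commTrace (G : Coord n → Matrix (Fin n) (Fin n) ℝ) (y : Coord n)
    (A : (Fin (k + 2) → Fin n) → ℝ) (E : Fin k → Fin n) (c d : Fin n) : ℝ :=
  ∑ a, ∑ b, (G y)⁻¹ a b * derivAct (fun f e => riemann G y c a e f) A (idx b d E)

/-- One term for each kind of slot hit by the derivation: the traced slot `b` yields Ricci, then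
come `d` and the entries of `E`. -/
theorem IsMetricOn.commTrace_eq (hG : IsMetricOn G U) {y : Coord n} (hy : y ∈ U)
    {A : (Fin (k + 2) → Fin n) → ℝ} (hA : IsSkew A) (E : Fin k → Fin n) (c d : Fin n) :
    commTrace G y A E c d = ∑ f, ricciUp G y f c * A (idx d f E)
      + ∑ a, ∑ e, riemannLow G y c a d e * raise (G y)⁻¹ (fun b f => A (idx b f E)) a e
      + ∑ i, ∑ a, ∑ e, riemannLow G y c a (E i) e *
          raise (G y)⁻¹ (fun b f => A (idx b d (Function.update E i f))) a e := by
  simp only [commTrace, derivAct_idx, mul_add, Finset.sum_add_distrib]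
  congr 1
  · congr 1
    · have h : ∀ f, ricciUp G y f c * A (idx d f E) =
          ∑ a, ∑ b, (G y)⁻¹ a b * riemann G y c a b f * A (idx f d E) := fun f => by
        simp only [← Finset.sum_mul, hG.sum_inv_riemann_eq_ricciUp hy, hA.idx_swap d f]
        ring
      simp only [h, Finset.mul_sum, mul_assoc]
      exact sum_rotate _
    · exact hG.sum_inv_mul_riemann hy _ c d
  · simp only [Finset.mul_sum (ι := Fin k)]
    have : ∀ i, _ := fun i =>
      hG.sum_inv_mul_riemann hy (fun b f => A (idx b d (Function.update E i f))) c (E i)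
    simp only [← this]
    exact sum_rotate _

/-- Trace the integrability condition with `g^{ab}`: both terms on its left are skew in `a, b`, and
those on its right give `-T_{dc}` and `-T_{cd}`. -/
theorem IsKillingYanoOn.commTrace_symm (hG : IsMetricOn G U)
    {A : Coord n → (Fin (k + 2) → Fin n) → ℝ} (hA : IsKillingYanoOn G A U) {y : Coord n}
    (hy : y ∈ U) (E : Fin k → Fin n) (c d : Fin n) :
    commTrace G y (A y) E c d + commTrace G y (A y) E d c = 0 := by
  set K : Fin n → Fin n → Fin n → Fin n → ℝ := fun a b c d =>
    derivAct (fun f e => riemann G y a b e f) (A y) (idx c d E) with hK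
  have hK1 : ∀ a b c d, K a b c d = - K b a c d := fun a b c d => by
    simp only [hK, derivAct, riemann_antisymm y a b, neg_mul, Finset.sum_neg_distrib]
  have hsym : ∀ S : Fin n → Fin n → ℝ, ∑ a, ∑ b, (G y)⁻¹ a b * S b a =
      ∑ a, ∑ b, (G y)⁻¹ a b * S a b := fun S => by
    rw [Finset.sum_comm]
    exact Finset.sum_congr rfl fun a _ => Finset.sum_congr rfl fun b _ => by
      rw [hG.inv_symm y b a]
  have hz : ∀ S : Fin n → Fin n → ℝ, (∀ a b, S a b = - S b a) →
      ∑ a, ∑ b, (G y)⁻¹ a b * S a b = 0 := fun S hS => by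
    have h1 := hsym S
    have h2 : ∑ a, ∑ b, (G y)⁻¹ a b * S b a = - ∑ a, ∑ b, (G y)⁻¹ a b * S a b := by
      simp only [← Finset.sum_neg_distrib]
      exact Finset.sum_congr rfl fun a _ => Finset.sum_congr rfl fun b _ => by rw [hS b a]; ring
    linarith
  have hK2 : ∀ a b c d, K c d a b = - K c d b a := fun a b c d => by
    exact IsSkew.idx_swap (A := derivAct (fun f e => riemann G y c d e f) (A y))
      (fun σ s => derivAct_comp_perm _ _ _ _ σ (hA.skew y σ) s) a b E
  have h := fun a b => hA.integrability hG hy a b c d E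
  have e1 := hz (fun a b => K a b c d) fun a b => hK1 a b c d
  have e2 := hz (fun a b => K c d a b) fun a b => hK2 a b c d
  have e3 : ∑ a, ∑ b, (G y)⁻¹ a b * K a d b c = - commTrace G y (A y) E d c := by
    simp only [commTrace, ← Finset.sum_neg_distrib, hK1 _ d]
    simp [hK]
  have e4 : ∑ a, ∑ b, (G y)⁻¹ a b * K b c a d = - commTrace G y (A y) E c d := by
    rw [hsym fun a b => K a c b d]
    simp only [commTrace, ← Finset.sum_neg_distrib, hK1 _ c]
    simp [hK]
  have : ∑ a, ∑ b, (G y)⁻¹ a b * K a b c d + ∑ a, ∑ b, (G y)⁻¹ a b * K c d a b =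
      ∑ a, ∑ b, (G y)⁻¹ a b * K a d b c + ∑ a, ∑ b, (G y)⁻¹ a b * K b c a d := by
    simp only [← Finset.sum_add_distrib, ← mul_add]
    exact Finset.sum_congr rfl fun a _ => Finset.sum_congr rfl fun b _ => by
      congr 1; exact h a b
  linarith

/-- Each slot of `E` contributes a Weyl contraction with an array skew in the two contracted
indices. The factor `k` appears because every slot gives the same term `R^f_c A_{dfE}`. -/
theorem IsMetricOn.hatWeyl_eq (hG : IsMetricOn G U) {y : Coord n} (hy : y ∈ U)
    {A : (Fin (k + 2) → Fin n) → ℝ} (hA : IsSkew A) (E : Fin k → Fin n) (c d : Fin n) :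
    hatWeyl (weylUp G y) A E c d =
      2 * ∑ i, ∑ a, ∑ e, riemannLow G y c a (E i) e *
          raise (G y)⁻¹ (fun b f => A (idx b d (Function.update E i f))) a e
      + 2 / ((n : ℝ) - 2) * (k * ∑ f, ricciUp G y f c * A (idx d f E)
        - ∑ i, ∑ f, ricciUp G y f (E i) * A (idx c d (Function.update E i f)))
      + 2 * (scalarCurv G y / (((n : ℝ) - 1) * ((n : ℝ) - 2))) * k * A (idx c d E) := by
  have hi : ∀ i, ∑ a, ∑ f, weylUp G y a f (E i) c * A (idx d a (Function.update E i f)) =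
      2 * ∑ a, ∑ e, riemannLow G y c a (E i) e *
          raise (G y)⁻¹ (fun b f => A (idx b d (Function.update E i f))) a e
      + 2 / ((n : ℝ) - 2) * (∑ f, ricciUp G y f c * A (idx d f E)
        - ∑ f, ricciUp G y f (E i) * A (idx c d (Function.update E i f)))
      + 2 * (scalarCurv G y / (((n : ℝ) - 1) * ((n : ℝ) - 2))) * A (idx c d E) := by
    intro i
    have hQ : ∀ a b, A (idx a d (Function.update E i b)) = - A (idx b d (Function.update E i a)) :=
      fun a b => hA.idx_update_swap a d b E i
    have h := hG.sum_weylUp y (fun a f => A (idx a d (Function.update E i f))) (E i) c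
    rw [hG.sum_weyl_mul_raise hy hQ] at h
    rw [hG.two_mul_sum_riemannLow hy (raise_antisymm (G y)⁻¹ hQ)]
    -- When a contraction puts `e_i` back into the form, exchanging it with the `f` in slot `i`
    -- restores `E`.
    have hE : ∀ f, A (idx (E i) d (Function.update E i f)) = A (idx d f E) := fun f => by
      rw [hQ, Function.update_eq_self, hA.idx_swap d f]
    simp only [hE] at h
    rw [hA.idx_swap d c] at h
    simp only [hA.idx_swap d _ (Function.update E i _), mul_neg, Finset.sum_neg_distrib, h]
    ring
  rw [hatWeyl]
  simp only [hi, Finset.sum_add_distrib, ← Finset.mul_sum, Finset.sum_sub_distrib,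
    Finset.sum_const, Finset.card_univ, Fintype.card_fin, nsmul_eq_mul]
  ring

theorem IsKillingYanoOn.ricci_identity_weyl (hG : IsMetricOn G U)
    {A : Coord n → (Fin (k + 2) → Fin n) → ℝ} (hA : IsKillingYanoOn G A U) {y : Coord n}
    (hy : y ∈ U) (c d : Fin n) (E : Fin k → Fin n) :
    2 * ((n : ℝ) - ((k + 2 : ℕ) : ℝ)) *
        symm2 (fun c d => ∑ f, ricciUp G y f c * A y (idx d f E)) c d
      + ((n : ℝ) - 2) * symm2 (fun c d => hatWeyl (weylUp G y) (A y) E c d) c d = 0 := by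
  have hs := hA.skew y
  -- Here the Weyl term has coefficient `0`. For `k = 0` also `n = p`; for `k > 0` the rank exceeds
  -- the dimension and `A = 0`.
  by_cases hn : n = 2
  · subst hn
    rcases Nat.eq_zero_or_pos k with rfl | hk
    · norm_num
    · simp only [symm2, hs.eq_zero_of_lt (by omega)]
      norm_num
  have hn' : (n : ℝ) - 2 ≠ 0 := sub_ne_zero.2 (by exact_mod_cast hn)
  have h := hA.commTrace_symm hG hy E c d
  have h2 := hG.sum_riemannLow_symm hy
    (raise_antisymm (G y)⁻¹ (Q := fun b f => A y (idx b f E)) fun a b => hs.idx_swap a b E) c d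
  rw [hG.commTrace_eq hy hs, hG.commTrace_eq hy hs] at h
  have h3 : ∑ i, ∑ f, ricciUp G y f (E i) * A y (idx d c (Function.update E i f)) =
      - ∑ i, ∑ f, ricciUp G y f (E i) * A y (idx c d (Function.update E i f)) := by
    simp only [hs.idx_swap d c, mul_neg, Finset.sum_neg_distrib]
  simp only [symm2, hG.hatWeyl_eq hy hs, h3, hs.idx_swap d c E]
  push_cast
  field_simp
  -- Since `2(n - p) + 2k = 2(n - 2)`, the Ricci terms combine with the Riemann contraction into `n
  -- - 2` times the symmetrized trace. The terms skew in `c, d` cancel.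
  linear_combination ((n : ℝ) - 2) * h - ((n : ℝ) - 2) * h2

end Contraction

/-! ### From the manifold to the components in a chart. -/

section Manifold

variable {n p : ℕ} {M : Type*} [TopologicalSpace M] [ChartedSpace (Coord n) M]

theorem mfderiv_symm_bijective {φ : OpenPartialHomeomorph M (Coord n)}
    (hφ : φ ∈ IsManifold.maximalAtlas (𝓡 n) ∞ M) {y : Coord n} (hy : y ∈ φ.target) :
    Function.Bijective (mfderiv (𝓡 n) (𝓡 n) φ.symm y) := by
  have hd : φ.MDifferentiable (𝓡 n) (𝓡 n) :=
    ⟨(contMDiffOn_of_mem_maximalAtlas hφ).mdifferentiableOn (by simp),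
      (contMDiffOn_symm_of_mem_maximalAtlas hφ).mdifferentiableOn (by simp)⟩
  exact hd.symm.mfderiv_bijective hy

/-- Only invertibility needs an argument: a kernel vector of the component matrix maps to a tangent
vector orthogonal to every coordinate vector. These span, so it is zero by nondegeneracy, and
injectivity of the differential of the inverse chart kills the kernel vector. -/
theorem PseudoMetric.isMetricOn_coord (g : PseudoMetric n M)
    {φ : OpenPartialHomeomorph M (Coord n)} (hφ : φ ∈ IsManifold.maximalAtlas (𝓡 n) ∞ M) :
    IsMetricOn (g.coord φ) φ.target where
  isOpen := φ.open_target
  smooth i j := g.smooth φ hφ i j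
  symm y i j := g.symm _ _ _
  det_ne_zero y hy hdet := by
    obtain ⟨v, hv, hv0⟩ := Matrix.exists_mulVec_eq_zero_iff.2 hdet
    have hb := mfderiv_symm_bijective hφ hy
    set L : Coord n →L[ℝ] TangentSpace (𝓡 n) (φ.symm y) := mfderiv (𝓡 n) (𝓡 n) φ.symm y with hL
    have hexp : ∀ w : Coord n, L w = ∑ j, w j • coordVec φ y j := fun w => by
      conv_lhs => rw [← (EuclideanSpace.basisFun (Fin n) ℝ).sum_repr w]
      rw [map_sum]
      simp only [map_smul, EuclideanSpace.basisFun_repr, EuclideanSpace.basisFun_apply]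
      rfl
    have h0 : L (WithLp.toLp 2 v) = 0 := by
      have hi : ∀ i, g.val (φ.symm y) (L (WithLp.toLp 2 v)) (coordVec φ y i) = 0 := fun i => by
        rw [g.symm, hexp, map_sum]
        refine Eq.trans ?_ (congrFun hv0 i)
        refine Finset.sum_congr rfl fun j _ => ?_
        rw [map_smul, smul_eq_mul, mul_comm]
        rfl
      refine g.nondegenerate _ _ fun w => ?_
      obtain ⟨u, hu⟩ := hb.2 w
      rw [← hu]
      change g.val (φ.symm y) (L (WithLp.toLp 2 v)) (L (show Coord n from u)) = 0
      rw [hexp (show Coord n from u), map_sum]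
      exact Finset.sum_eq_zero fun i _ => by rw [map_smul, hi, smul_zero]
    have := hb.1 (h0.trans (map_zero L).symm)
    exact hv (funext fun i => congrFun (congrArg WithLp.ofLp this) i)

theorem IsKillingYano.isKillingYanoOn_coord {g : PseudoMetric n M} {A : SkewTensor n p M}
    (hA : IsKillingYano g A) {φ : OpenPartialHomeomorph M (Coord n)}
    (hφ : φ ∈ IsManifold.maximalAtlas (𝓡 n) ∞ M) :
    IsKillingYanoOn (g.coord φ) (A.coord φ) φ.target where
  smooth b := A.smooth φ hφ b
  skew y σ s := by
    have := (A.val (φ.symm y)).toAlternatingMap.map_perm (fun i => coordVec φ y (s i)) σ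
    rw [Units.smul_def, zsmul_eq_mul] at this
    exact this
  killingYano y hy s := hA φ hφ y hy s

end Manifold

end KillingYano

theorem mainTheorem6 {n k : ℕ} {M : Type*} [TopologicalSpace M]
    [ChartedSpace (KillingYano.Coord n) M] [IsManifold (𝓡 n) ∞ M]
    (g : KillingYano.PseudoMetric n M) (A : KillingYano.SkewTensor n (k + 2) M)
    (hA : KillingYano.IsKillingYano g A)
    (φ : OpenPartialHomeomorph M (KillingYano.Coord n))
    (hφ : φ ∈ IsManifold.maximalAtlas (𝓡 n) ∞ M)
    (y : KillingYano.Coord n) (hy : y ∈ φ.target) :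
    (∀ (a b c d : Fin n) (E : Fin k → Fin n),
      (0 : ℝ) =
        ∑ f, g.riem φ y f a c b * A.coord φ y (KillingYano.idx d f E)
          + ∑ f, g.riem φ y f b d a * A.coord φ y (KillingYano.idx c f E)
          + ∑ f, g.riem φ y f c a d * A.coord φ y (KillingYano.idx b f E)
          + ∑ f, g.riem φ y f d b c * A.coord φ y (KillingYano.idx a f E)
          + KillingYano.antisymm
              (fun s => KillingYano.hatRiemann (g.riem φ y) (A.coord φ y) E (s 0) (s 1) (s 2) a) ![b, c, d]
          + 2 * KillingYano.antisymm
              (fun s => KillingYano.hatRiemann (g.riem φ y) (A.coord φ y) E a (s 0) (s 1) (s 2)) ![b, c, d]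
          + 2 * KillingYano.hatRiemann (g.riem φ y) (A.coord φ y) E b c a d
          - 3 * KillingYano.antisymm
              (fun s => KillingYano.hatRiemann (g.riem φ y) (A.coord φ y) E (s 0) (s 1) (s 2) d) ![a, b, c]) ∧
    (∀ (c d : Fin n) (E : Fin k → Fin n),
      2 * ((n : ℝ) - ((k + 2 : ℕ) : ℝ)) *
            KillingYano.symm2 (fun c d => ∑ f, g.ric φ y f c * A.coord φ y (KillingYano.idx d f E)) c d
          + ((n : ℝ) - 2) *
            KillingYano.symm2 (fun c d => KillingYano.hatWeyl (g.wey φ y) (A.coord φ y) E c d) c d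
        = 0) := by
  have hG := g.isMetricOn_coord hφ
  have hA' := hA.isKillingYanoOn_coord hφ
  exact ⟨fun a b c d E => hA'.riemann_identity hG hy a b c d E,
    fun c d E => hA'.ricci_identity_weyl hG hy c d E⟩
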